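/- For $b\in\mathbb{C}$ that is not a non-positive integer, let $\zeta(k,b)$ denote the Hurwitz zeta function, that is, the analytic continuation in $k$ to $\mathbb{C}\setminus\{1\}$ of $\sum_{n\ge 0}(n+b)^{-k}$, $\Re(k)>1$ (all powers are principal values). For every $b\in\mathbb{C}$ with $\Re(b)>0$ this continuation exists, and for every complex $k\neq 1$ the integral below converges absolutely and $$\zeta(k,b)=\frac{b^{1-k}}{k-1}+\frac{b^{-k}}{2}+\frac{\pi\,b^{2-k}}{k-1}\int_{0}^{\pi/2}\bigl(\sec v\,\operatorname{csch}(\pi b\tan v)\bigr)^2\left(1-\frac{\cos((k-1)v)}{(\cos v)^{1-k}}\right)dv .$$ If the last term is multiplied by $\operatorname{sgn}(\Re(b))$, which changes nothing for $\Re(b)>0$, the identity still does not always hold for $\Re(b)<0$: there are $k\ne 1$ and $b$ with $\Re(b)<0$, $b\notin\{0,-1,-2,\dots\}$, for which $\zeta(\cdot,b)$ exists and the integral converges absolutely, but the two sides differ. -/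

import Mathlib

namespace HurwitzInt

/-- `Z` is the Hurwitz zeta function `k ↦ ζ(k, b)`: it is holomorphic on `ℂ \ {1}` and is given on
the half-plane `Re k > 1` by the convergent series `∑_{n ≥ 0} (n + b)^(-k)` (principal powers). -/
def IsHurwitzZeta (b : ℂ) (Z : ℂ → ℂ) : Prop :=
  DifferentiableOn ℂ Z {1}ᶜ ∧
    ∀ k : ℂ, 1 < k.re → HasSum (fun n : ℕ => ((n : ℂ) + b) ^ (-k)) (Z k)

/-- The analytic continuation of the Hurwitz series is unique away from `1`. -/
theorem IsHurwitzZeta.eqOn {b : ℂ} {Z W : ℂ → ℂ} (hZ : IsHurwitzZeta b Z)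
    (hW : IsHurwitzZeta b W) : Set.EqOn Z W {1}ᶜ := by
  have ho : IsOpen ({1}ᶜ : Set ℂ) := isOpen_compl_singleton
  have hc : IsPreconnected ({1}ᶜ : Set ℂ) :=
    (isConnected_compl_singleton_of_one_lt_rank (by simp) (1 : ℂ)).isPreconnected
  refine (hZ.1.analyticOnNhd ho).eqOn_of_preconnected_of_eventuallyEq (hW.1.analyticOnNhd ho) hc
    (z₀ := 2) (by simp) ?_
  have h2 : {k : ℂ | 1 < k.re} ∈ nhds (2 : ℂ) :=
    (isOpen_lt continuous_const Complex.continuous_re).mem_nhds (by simp)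
  filter_upwards [h2] with k hk
  exact (hZ.2 k hk).unique (hW.2 k hk)

open Classical in
/-- The Hurwitz zeta function `ζ(k, b)` with complex parameter `b`, as the analytic continuation in
`k` of `∑_{n ≥ 0} (n + b)^(-k)` (the value `0` is used if there were no such continuation). -/
noncomputable def hurwitzZeta (k b : ℂ) : ℂ :=
  if h : ∃ Z : ℂ → ℂ, IsHurwitzZeta b Z then h.choose k else 0

/-- The complex secant. -/
noncomputable def sec (z : ℂ) : ℂ := 1 / Complex.cos z

/-- The complex hyperbolic cosecant. -/
noncomputable def csch (z : ℂ) : ℂ := 1 / Complex.sinh z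

/-- The integrand `(sec v csch(π b tan v))² (1 - cos((k-1)v) / (cos v)^(1-k))`. -/
noncomputable def integrand (k b : ℂ) (v : ℝ) : ℂ :=
  (sec v * csch (Real.pi * b * Complex.tan v)) ^ 2 *
    (1 - Complex.cos ((k - 1) * v) / Complex.cos v ^ (1 - k))

/-- The right-hand side of the integral representation, with the sign of `Re b`. -/
noncomputable def integralFormula (k b : ℂ) : ℂ :=
  b ^ (1 - k) / (k - 1) + b ^ (-k) / 2 +
    Real.sign b.re * Real.pi * b ^ (2 - k) / (k - 1) *
      ∫ v in (0 : ℝ)..(Real.pi / 2), integrand k b v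

end HurwitzInt

open MeasureTheory Set Filter Topology

namespace HurwitzInt

/-! With `t = tan v` the integral becomes `kernelIntegral k b`, the integral over `t > 0` of `csch
(π b t) ^ 2` times `1 - ((1 + it)^(1-k) + (1 - it)^(1-k)) / 2`. For `Re k > 1` and real `b > 0`,
summing a geometric series gives `Γ(k) ζ(k,b) = ∫ t^(k-1) e^(-bt) / (1 - e^(-t)) dt`. Into this goes
`t / (1 - e^(-t)) = 1 + t/2 + π ∫ (1 - cos(xt)) / sinh(πx)^2 dx`
(`integral_one_sub_cos_div_sinh_sq`). Fubini leaves Gamma integrals of rates `b` and `b(1 ± ix)`,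
which produce the three terms (`integral_cpow_mul_exp_div_eq`).

For `Re k > 1` the identity theorem in `b` reaches all `Re b > 0`. The formula is holomorphic in `k
≠ 1`, so it is itself the continuation (`isHurwitzZeta_zetaFormula`), and uniqueness finishes.

The failure occurs at `k = 2`, `b = -1/2`: the integral is even in `b`, while `ζ(2,-1/2) = 4 +
ζ(2,1/2)`; equality would force `ζ(2,1/2) = 0`. -/

/-! ### Holomorphy in a parameter and the complex Gamma integral. -/

/-- An integral of holomorphic functions that is locally uniformly dominated is holomorphic in the
parameter. -/
theorem differentiableOn_integral_of_locally_dominated {α : Type*} [MeasurableSpace α]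
    {μ : Measure α} {F : ℂ → α → ℂ} {U : Set ℂ} (hU : IsOpen U)
    (hmeas : ∀ z ∈ U, AEStronglyMeasurable (F z) μ)
    (hdiff : ∀ᵐ a ∂μ, DifferentiableOn ℂ (fun z => F z a) U)
    (hbound : ∀ z₀ ∈ U, ∃ s ∈ 𝓝 z₀, ∃ bound : α → ℝ, Integrable bound μ ∧
      ∀ᵐ a ∂μ, ∀ z ∈ s, ‖F z a‖ ≤ bound a) :
    DifferentiableOn ℂ (fun z => ∫ a, F z a ∂μ) U := by
  intro z₀ hz₀
  obtain ⟨s, hs, bound, hbi, hb⟩ := hbound z₀ hz₀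
  obtain ⟨ε, hε, hball⟩ := Metric.mem_nhds_iff.1 (Filter.inter_mem hs (hU.mem_nhds hz₀))
  have hz₀s : z₀ ∈ s := (hball (Metric.mem_ball_self hε)).1
  have hderiv : ∀ᵐ a ∂μ, ∀ z ∈ U, HasDerivAt (fun z => F z a) (deriv (fun z => F z a) z) z := by
    filter_upwards [hdiff] with a ha z hz
    exact (ha.differentiableAt (hU.mem_nhds hz)).hasDerivAt
  have hball2 : ∀ z ∈ Metric.ball z₀ (ε / 2), Metric.closedBall z (ε / 2) ⊆ s ∩ U := by
    intro z hz
    refine (fun w hw => hball ?_)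
    rw [Metric.mem_ball] at hz ⊢
    rw [Metric.mem_closedBall] at hw
    linarith [dist_triangle w z z₀]
  refine (hasDerivAt_integral_of_dominated_loc_of_deriv_le
    (F' := fun z a => deriv (fun z => F z a) z) (bound := fun a => bound a / (ε / 2))
    (Metric.ball_mem_nhds z₀ (half_pos hε)) ?_ ?_ ?_ ?_ (hbi.div_const _) ?_).2.differentiableAt
    |>.differentiableWithinAt
  · filter_upwards [hU.mem_nhds hz₀] with z hz using hmeas z hz
  · refine hbi.mono' (hmeas z₀ hz₀) ?_
    filter_upwards [hb] with a ha using ha z₀ hz₀s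
  -- The derivative is measurable as an a.e. limit of difference quotients along a null sequence;
  -- steps of size at most `ε / 2` stay inside the ball.
  · set u : ℕ → ℂ := fun n => ((ε / 2 / (n + 1) : ℝ) : ℂ) with hu
    have hpos : ∀ n : ℕ, 0 < ε / 2 / ((n : ℝ) + 1) := fun n => by positivity
    have hu0 : ∀ n, u n ≠ 0 := fun n => by
      simpa only [hu, ne_eq, Complex.ofReal_eq_zero] using (hpos n).ne'
    have hlim : Tendsto u atTop (𝓝[≠] 0) := by
      refine tendsto_nhdsWithin_iff.2 ⟨?_, Eventually.of_forall hu0⟩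
      have h : Tendsto (fun n : ℕ => ε / 2 / ((n : ℝ) + 1)) atTop (𝓝 0) :=
        tendsto_const_nhds.div_atTop
          (tendsto_atTop_add_const_right _ _ tendsto_natCast_atTop_atTop)
      exact (Complex.continuous_ofReal.tendsto' 0 0 (by simp)).comp h
    have hmem : ∀ n, z₀ + u n ∈ U := by
      intro n
      refine (hball ?_).2
      have h1 : ‖u n‖ = ε / 2 / ((n : ℝ) + 1) := by
        simp only [hu, Complex.norm_real, Real.norm_eq_abs, abs_of_pos (hpos n)]
      have h2 : ε / 2 / ((n : ℝ) + 1) ≤ ε / 2 :=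
        div_le_self (by positivity) (by linarith [Nat.cast_nonneg (α := ℝ) n])
      simp only [Metric.mem_ball, dist_self_add_left, h1]
      linarith
    refine aestronglyMeasurable_of_tendsto_ae atTop
      (f := fun n a => (u n)⁻¹ • (F (z₀ + u n) a - F z₀ a))
      (fun n => AEStronglyMeasurable.const_smul
        (f := fun a => F (z₀ + u n) a - F z₀ a) ((hmeas _ (hmem n)).sub (hmeas z₀ hz₀)) (u n)⁻¹) ?_
    filter_upwards [hderiv] with a ha
    exact (hasDerivAt_iff_tendsto_slope_zero.1 (ha z₀ hz₀)).comp hlim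
  · filter_upwards [hb, hdiff] with a ha hda z hz
    -- Cauchy's estimate on circles of radius `ε / 2`, whence the dominating function `bound a / (ε
    -- / 2)`.
    refine Complex.norm_deriv_le_of_forall_mem_sphere_norm_le (half_pos hε) ?_ ?_
    · refine DifferentiableOn.diffContOnCl (hda.mono ?_)
      exact (Metric.closure_ball_subset_closedBall).trans
        ((hball2 z hz).trans inter_subset_right)
    · exact fun w hw => ha w (hball2 z hz (Metric.sphere_subset_closedBall hw)).1
  · filter_upwards [hderiv] with a ha z hz
    exact ha z (hball2 z hz (Metric.mem_closedBall_self (half_pos hε).le)).2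

/-- The identity theorem on the right half-plane, with agreement on the positive reals. -/
theorem eqOn_re_pos_of_eq_ofReal {f g : ℂ → ℂ} (hf : DifferentiableOn ℂ f {z | 0 < z.re})
    (hg : DifferentiableOn ℂ g {z | 0 < z.re}) (h : ∀ x : ℝ, 0 < x → f x = g x) :
    EqOn f g {z | 0 < z.re} := by
  have ho : IsOpen {z : ℂ | 0 < z.re} := isOpen_lt continuous_const Complex.continuous_re
  refine (hf.analyticOnNhd ho).eqOn_of_preconnected_of_frequently_eq (hg.analyticOnNhd ho)
    (convex_halfSpace_re_gt 0).isPreconnected (z₀ := 1) (by simp) ?_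
  have hlim : Tendsto (fun n : ℕ => ((1 + 1 / ((n : ℝ) + 1) : ℝ) : ℂ)) atTop (𝓝[≠] 1) := by
    refine tendsto_nhdsWithin_iff.2 ⟨?_, Eventually.of_forall fun n => ?_⟩
    · have := (tendsto_one_div_add_atTop_nhds_zero_nat (𝕜 := ℝ)).const_add 1
      rw [add_zero] at this
      exact (Complex.continuous_ofReal.tendsto' 1 1 (by simp)).comp this
    · simp only [mem_compl_iff, mem_singleton_iff]
      intro h1
      have h2 : (1 + 1 / ((n : ℝ) + 1) : ℝ) = 1 := by exact_mod_cast h1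
      have : 0 < 1 / ((n : ℝ) + 1) := by positivity
      linarith
  exact hlim.frequently (Frequently.of_forall fun n => h _ (by positivity))

theorem integrableOn_cpow_mul_exp_neg_mul_Ioi {a r : ℂ} (ha : 0 < a.re) (hr : 0 < r.re) :
    IntegrableOn (fun t : ℝ => (t : ℂ) ^ (a - 1) * Complex.exp (-(r * t))) (Ioi 0) := by
  have hb := integrableOn_rpow_mul_exp_neg_mul_rpow (s := a.re - 1) (p := 1) (b := r.re)
    (by linarith) one_pos hr
  refine hb.mono' ?_ ?_
  · refine ContinuousOn.aestronglyMeasurable (fun t ht => ?_) measurableSet_Ioi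
    refine ContinuousAt.continuousWithinAt (ContinuousAt.mul ?_ (by fun_prop))
    exact (continuousAt_cpow_const (Complex.ofReal_mem_slitPlane.2 ht)).comp
      Complex.continuous_ofReal.continuousAt
  · refine ae_restrict_of_forall_mem measurableSet_Ioi fun t ht => ?_
    rw [norm_mul, Complex.norm_cpow_eq_rpow_re_of_pos ht, Complex.norm_exp]
    simp

/-- The Gamma integral with a complex rate. -/
theorem integral_cpow_mul_exp_neg_mul_Ioi_of_re_pos {a r : ℂ} (ha : 0 < a.re) (hr : 0 < r.re) :
    ∫ t : ℝ in Ioi 0, (t : ℂ) ^ (a - 1) * Complex.exp (-(r * t)) =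
      r ^ (-a) * Complex.Gamma a := by
  have ho : IsOpen {z : ℂ | 0 < z.re} := isOpen_lt continuous_const Complex.continuous_re
  refine eqOn_re_pos_of_eq_ofReal
    (f := fun r => ∫ t : ℝ in Ioi 0, (t : ℂ) ^ (a - 1) * Complex.exp (-(r * t)))
    (g := fun r => r ^ (-a) * Complex.Gamma a) ?_ ?_ ?_ hr
  · refine differentiableOn_integral_of_locally_dominated ho
      (fun z hz => (integrableOn_cpow_mul_exp_neg_mul_Ioi ha hz).aestronglyMeasurable)
      (Eventually.of_forall fun t => by fun_prop) fun z₀ hz₀ => ?_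
    have hz₀' : 0 < z₀.re := hz₀
    refine ⟨{z | z₀.re / 2 < z.re}, (isOpen_lt continuous_const
      Complex.continuous_re).mem_nhds (by simp [hz₀']), _,
      (integrableOn_cpow_mul_exp_neg_mul_Ioi (r := ((z₀.re / 2 : ℝ) : ℂ)) ha
        (by rw [Complex.ofReal_re]; linarith)).norm, ?_⟩
    refine ae_restrict_of_forall_mem measurableSet_Ioi fun t ht z hz => ?_
    have ht' : 0 < t := ht
    have hz' : z₀.re / 2 < z.re := hz
    rw [norm_mul, norm_mul, Complex.norm_exp, Complex.norm_exp]
    refine mul_le_mul_of_nonneg_left (Real.exp_le_exp.2 ?_) (norm_nonneg _)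
    simp only [Complex.neg_re, Complex.mul_re, Complex.ofReal_re, Complex.ofReal_im]
    nlinarith
  · intro z hz
    refine ((differentiableAt_id.cpow_const (Or.inl hz)).mul_const _).differentiableWithinAt
  · intro x hx
    have := Complex.integral_cpow_mul_exp_neg_mul_Ioi ha hx
    rw [this, one_div, Complex.cpow_neg, Complex.inv_cpow]
    rw [Complex.arg_ofReal_of_nonneg hx.le]
    exact Real.pi_pos.ne

/-! ### The kernel: regularity and growth. -/

/-- The factor `1 - cos((k-1)v) / (cos v)^(1-k)` of the integrand, in the variable `t = tan v`. -/
noncomputable def kernel (k : ℂ) (t : ℝ) : ℂ :=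
  1 - ((1 + t * Complex.I) ^ (1 - k) + (1 - t * Complex.I) ^ (1 - k)) / 2

theorem one_add_mul_I_mem_slitPlane (t : ℝ) : 1 + t * Complex.I ∈ Complex.slitPlane :=
  Or.inl (by simp)

theorem one_sub_mul_I_mem_slitPlane (t : ℝ) : 1 - t * Complex.I ∈ Complex.slitPlane :=
  Or.inl (by simp)

theorem hasDerivAt_one_add_mul_I_cpow (w : ℂ) (t : ℝ) :
    HasDerivAt (fun s : ℝ => (1 + s * Complex.I) ^ w)
      (w * (1 + t * Complex.I) ^ (w - 1) * Complex.I) t := by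
  have h : HasDerivAt (fun s : ℝ => 1 + (s : ℂ) * Complex.I) Complex.I t := by
    simpa using ((Complex.ofRealCLM.hasDerivAt (x := t)).mul_const Complex.I).const_add 1
  have h' := ((hasDerivAt_id _).cpow_const (c := w) (one_add_mul_I_mem_slitPlane t)).comp t h
  exact h'.congr_deriv (by simp)

theorem hasDerivAt_one_sub_mul_I_cpow (w : ℂ) (t : ℝ) :
    HasDerivAt (fun s : ℝ => (1 - s * Complex.I) ^ w)
      (w * (1 - t * Complex.I) ^ (w - 1) * (-Complex.I)) t := by
  have h : HasDerivAt (fun s : ℝ => 1 - (s : ℂ) * Complex.I) (-Complex.I) t := by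
    simpa using ((Complex.ofRealCLM.hasDerivAt (x := t)).mul_const Complex.I).const_sub 1
  have h' := ((hasDerivAt_id _).cpow_const (c := w) (one_sub_mul_I_mem_slitPlane t)).comp t h
  exact h'.congr_deriv (by simp)

theorem continuous_kernel (k : ℂ) : Continuous (kernel k) := by
  have h1 : Continuous fun s : ℝ => (1 + (s : ℂ) * Complex.I) ^ (1 - k) :=
    continuous_iff_continuousAt.2 fun t => (hasDerivAt_one_add_mul_I_cpow _ t).continuousAt
  have h2 : Continuous fun s : ℝ => (1 - (s : ℂ) * Complex.I) ^ (1 - k) :=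
    continuous_iff_continuousAt.2 fun t => (hasDerivAt_one_sub_mul_I_cpow _ t).continuousAt
  unfold kernel
  fun_prop

theorem differentiable_kernel (t : ℝ) : Differentiable ℂ fun k => kernel k t := by
  have h1 : 1 + (t : ℂ) * Complex.I ≠ 0 :=
    Complex.slitPlane_ne_zero (one_add_mul_I_mem_slitPlane t)
  have h2 : 1 - (t : ℂ) * Complex.I ≠ 0 :=
    Complex.slitPlane_ne_zero (one_sub_mul_I_mem_slitPlane t)
  intro k
  have h3 : DifferentiableAt ℂ (fun k : ℂ => 1 - k) k := by fun_prop
  exact (((h3.const_cpow (Or.inl h1)).add (h3.const_cpow (Or.inl h2))).div_const 2).const_sub 1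

/-- The base has modulus at least `1`, so its real exponent may be raised to `N`; the argument
contributes at most `exp (π N)`. -/
theorem norm_one_add_mul_I_cpow_le {w : ℂ} {N : ℕ} (hw : ‖w‖ ≤ N) {s t : ℝ} (hs : |s| ≤ t) :
    ‖(1 + s * Complex.I) ^ w‖ ≤ Real.exp (Real.pi * N) * (1 + t) ^ N := by
  set z : ℂ := 1 + s * Complex.I
  have hz1 : 1 ≤ ‖z‖ := by simpa [z] using Complex.re_le_norm z
  have hz2 : ‖z‖ ≤ 1 + t := by
    refine (norm_add_le _ _).trans ?_
    simpa using hs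
  have h1 : ‖z‖ ^ w.re ≤ (1 + t) ^ N := by
    calc ‖z‖ ^ w.re ≤ ‖z‖ ^ (N : ℝ) :=
          Real.rpow_le_rpow_of_exponent_le hz1 ((Complex.re_le_norm w).trans hw)
      _ = ‖z‖ ^ N := Real.rpow_natCast _ _
      _ ≤ (1 + t) ^ N := by gcongr
  have h2 : -(Complex.arg z * w.im) ≤ Real.pi * N := by
    refine (neg_le_abs _).trans ?_
    rw [abs_mul]
    exact mul_le_mul (Complex.abs_arg_le_pi z) ((Complex.abs_im_le_norm w).trans hw)
      (abs_nonneg _) Real.pi_pos.le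
  calc ‖z ^ w‖ ≤ ‖z‖ ^ w.re / Real.exp (Complex.arg z * w.im) := Complex.norm_cpow_le z w
    _ = Real.exp (-(Complex.arg z * w.im)) * ‖z‖ ^ w.re := by rw [Real.exp_neg]; ring
    _ ≤ _ := by gcongr

theorem norm_one_sub_mul_I_cpow_le {w : ℂ} {N : ℕ} (hw : ‖w‖ ≤ N) {s t : ℝ} (hs : |s| ≤ t) :
    ‖(1 - s * Complex.I) ^ w‖ ≤ Real.exp (Real.pi * N) * (1 + t) ^ N := by
  have h := norm_one_add_mul_I_cpow_le (s := -s) (t := t) hw (by rwa [abs_neg])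
  rwa [Complex.ofReal_neg, neg_mul, ← sub_eq_add_neg] at h

/-- The kernel vanishes to second order at `0` and grows polynomially. -/
theorem norm_kernel_le {k : ℂ} {N : ℕ} (hk : ‖k‖ ≤ N) {t : ℝ} (ht : 0 ≤ t) :
    ‖kernel k t‖ ≤
      (1 + N) * N * Real.exp (Real.pi * (N + 1 : ℕ)) * (1 + t) ^ (N + 1) * t * t := by
  set D : ℝ := (1 + N) * N * Real.exp (Real.pi * (N + 1 : ℕ)) * (1 + t) ^ (N + 1) with hD
  have hD0 : 0 ≤ D := by positivity
  -- `h'` and `h''` are the first two derivatives of the kernel. Both `kernel k 0` and `h' 0`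
  -- vanish, so the bound `D` on `h''` integrates twice. In `D`, the factors `1 + N` and `N` bound
  -- `‖1 - k‖` and `‖k‖`, and `N + 1` bounds the exponent `-(k + 1)`.
  set h' : ℝ → ℂ := fun s => -((1 - k) * (1 + s * Complex.I) ^ (1 - k - 1) * Complex.I +
    (1 - k) * (1 - s * Complex.I) ^ (1 - k - 1) * (-Complex.I)) / 2 with hh'
  set h'' : ℝ → ℂ := fun s => (1 - k) * (1 - k - 1) *
    ((1 + s * Complex.I) ^ (1 - k - 1 - 1) + (1 - s * Complex.I) ^ (1 - k - 1 - 1)) / 2 with hh''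
  have hd1 : ∀ s : ℝ, HasDerivAt (kernel k) (h' s) s := by
    intro s
    have : HasDerivAt (kernel k) _ s := (((hasDerivAt_one_add_mul_I_cpow (1 - k) s).add
      (hasDerivAt_one_sub_mul_I_cpow (1 - k) s)).div_const 2).const_sub 1
    refine this.congr_deriv ?_
    simp only [hh']
    ring
  have hd2 : ∀ s : ℝ, HasDerivAt h' (h'' s) s := by
    intro s
    have : HasDerivAt h' _ s := ((((hasDerivAt_one_add_mul_I_cpow (1 - k - 1) s).const_mul (1 - k)).mul_const
      Complex.I).add (((hasDerivAt_one_sub_mul_I_cpow (1 - k - 1) s).const_mul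
      (1 - k)).mul_const (-Complex.I))).neg.div_const 2
    refine this.congr_deriv ?_
    simp only [hh'']
    ring_nf
    simp only [Complex.I_sq]
    ring
  have hk1 : ‖1 - k‖ ≤ 1 + N := (norm_sub_le _ _).trans (by simpa using hk)
  have hk2 : ‖1 - k - 1‖ ≤ N := by simpa using hk
  have hk3 : ‖1 - k - 1 - 1‖ ≤ (N + 1 : ℕ) := by
    rw [show 1 - k - 1 - 1 = -(k + 1) by ring, norm_neg]
    refine (norm_add_le _ _).trans ?_
    push_cast
    simpa using hk
  have hb2 : ∀ s ∈ Icc 0 t, ‖h'' s‖ ≤ D := by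
    intro s hs
    have hst : |s| ≤ t := by rw [abs_of_nonneg hs.1]; exact hs.2
    have e1 := norm_one_add_mul_I_cpow_le hk3 hst
    have e2 := norm_one_sub_mul_I_cpow_le hk3 hst
    set A := Real.exp (Real.pi * (N + 1 : ℕ)) * (1 + t) ^ (N + 1)
    have e3 : ‖(1 + s * Complex.I) ^ (1 - k - 1 - 1) + (1 - s * Complex.I) ^ (1 - k - 1 - 1)‖
        ≤ 2 * A := (norm_add_le _ _).trans (by linarith)
    calc ‖h'' s‖ = ‖1 - k‖ * ‖1 - k - 1‖ * ‖(1 + s * Complex.I) ^ (1 - k - 1 - 1) +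
          (1 - s * Complex.I) ^ (1 - k - 1 - 1)‖ / 2 := by simp only [hh'', norm_mul, norm_div,
            Complex.norm_ofNat]
      _ ≤ (1 + N) * N * (2 * A) / 2 := by gcongr
      _ = D := by rw [hD]; ring
  have hb1 : ∀ s ∈ Icc 0 t, ‖h' s‖ ≤ D * t := by
    intro s hs
    have := Convex.norm_image_sub_le_of_norm_hasDerivWithin_le
      (fun x _ => (hd2 x).hasDerivWithinAt) hb2 (convex_Icc 0 t) (left_mem_Icc.2 ht) hs
    have h0 : h' 0 = 0 := by simp [hh']
    rw [h0, sub_zero, sub_zero, Real.norm_of_nonneg hs.1] at this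
    exact this.trans (mul_le_mul_of_nonneg_left hs.2 hD0)
  have := Convex.norm_image_sub_le_of_norm_hasDerivWithin_le
    (fun x _ => (hd1 x).hasDerivWithinAt) hb1 (convex_Icc 0 t) (left_mem_Icc.2 ht)
    (right_mem_Icc.2 ht)
  have h0 : kernel k 0 = 0 := by simp [kernel]
  rwa [h0, sub_zero, sub_zero, Real.norm_of_nonneg ht] at this

/-! ### Decay of `csch` and convergence of the kernel integral. -/

/-- From `sinh x = 2 sinh (x/2) cosh (x/2)`. The factor `x` records the order of the pole of `csch`
at `0`, which the double zero of the kernel cancels; the exponential gives decay at infinity. -/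
theorem le_sinh_mul_exp {x : ℝ} (hx : 0 ≤ x) : x * Real.exp (x / 2) / 2 ≤ Real.sinh x := by
  have h1 : x / 2 ≤ Real.sinh (x / 2) := Real.self_le_sinh_iff.2 (by linarith)
  have h2 : Real.exp (x / 2) / 2 ≤ Real.cosh (x / 2) := by
    rw [Real.cosh_eq]
    linarith [Real.exp_pos (-(x / 2))]
  have h3 : Real.sinh x = 2 * Real.sinh (x / 2) * Real.cosh (x / 2) := by
    rw [← Real.sinh_two_mul]; ring_nf
  rw [h3]
  nlinarith [Real.exp_pos (x / 2), Real.cosh_pos (x / 2)]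

theorem sinh_re_le_norm_sinh (z : ℂ) : Real.sinh z.re ≤ ‖Complex.sinh z‖ := by
  have h : ‖Complex.exp z‖ - ‖Complex.exp (-z)‖ ≤ ‖Complex.exp z - Complex.exp (-z)‖ :=
    norm_sub_norm_le _ _
  rw [Complex.norm_exp, Complex.norm_exp, Complex.neg_re] at h
  rw [Complex.sinh, norm_div, Complex.norm_ofNat, Real.sinh_eq]
  linarith

theorem norm_csch_le {z : ℂ} {x : ℝ} (hx : 0 < x) (hxz : x ≤ z.re) :
    ‖csch z‖ ≤ 2 * Real.exp (-(x / 2)) / x := by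
  have h1 : x * Real.exp (x / 2) / 2 ≤ ‖Complex.sinh z‖ :=
    (le_sinh_mul_exp hx.le).trans ((Real.sinh_le_sinh.2 hxz).trans (sinh_re_le_norm_sinh z))
  have h2 : 0 < x * Real.exp (x / 2) / 2 := by positivity
  rw [csch, norm_div, norm_one]
  calc 1 / ‖Complex.sinh z‖ ≤ 1 / (x * Real.exp (x / 2) / 2) := by gcongr
    _ = _ := by rw [Real.exp_neg]; field_simp

theorem sinh_ne_zero_of_re_pos {z : ℂ} (hz : 0 < z.re) : Complex.sinh z ≠ 0 :=
  norm_pos_iff.1 ((Real.sinh_pos_iff.2 hz).trans_le (sinh_re_le_norm_sinh z))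

theorem re_pi_mul_mul_ofReal (b : ℂ) (t : ℝ) :
    (Real.pi * b * t).re = Real.pi * b.re * t := by
  simp

/-- A locally uniform exponential bound for the integrand in the variable `t = tan v`. -/
theorem exists_norm_csch_sq_mul_kernel_le (N : ℕ) {β : ℝ} (hβ : 0 < β) :
    ∃ C : ℝ, ∀ k b : ℂ, ∀ t : ℝ, ‖k‖ ≤ N → β ≤ b.re → 0 < t →
      ‖csch (Real.pi * b * t) ^ 2 * kernel k t‖ ≤ C * Real.exp (-β * t) := by
  set A : ℝ := (1 + N) * N * Real.exp (Real.pi * (N + 1 : ℕ))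
  set M : ℕ := N + 1
  refine ⟨4 * A / (Real.pi * β) ^ 2 * (M.factorial / β ^ M * Real.exp β), ?_⟩
  intro k b t hk hb ht
  have hπ := Real.pi_gt_three
  have hx : 0 < Real.pi * β * t := by positivity
  have h1 : ‖csch (Real.pi * b * t)‖ ≤ _ := norm_csch_le (z := Real.pi * b * t) hx (by
    rw [re_pi_mul_mul_ofReal]; gcongr)
  have h2 := norm_kernel_le hk ht.le
  -- One term of the exponential series absorbs the polynomial growth of the kernel.
  have h3 : (1 + t) ^ M ≤ M.factorial / β ^ M * Real.exp (β * (1 + t)) := by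
    have := Real.pow_div_factorial_le_exp (β * (1 + t)) (by positivity) M
    rw [div_le_iff₀ (by positivity), mul_pow] at this
    rw [div_mul_eq_mul_div, le_div_iff₀ (by positivity)]
    linarith
  -- Since `π > 2`, the decay `exp (-π β t)` outweighs `exp (β t)` and still leaves `exp (-β t)`.
  have h4 : Real.exp (-(Real.pi * β * t / 2)) ^ 2 * Real.exp (β * (1 + t)) ≤
      Real.exp β * Real.exp (-β * t) := by
    rw [← Real.exp_nat_mul, ← Real.exp_add, ← Real.exp_add, Real.exp_le_exp]
    push_cast
    nlinarith [mul_pos hβ ht]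
  rw [norm_mul, norm_pow]
  calc ‖csch (Real.pi * b * t)‖ ^ 2 * ‖kernel k t‖
      ≤ (2 * Real.exp (-(Real.pi * β * t / 2)) / (Real.pi * β * t)) ^ 2 *
        (A * (M.factorial / β ^ M * Real.exp (β * (1 + t))) * t * t) := by
        gcongr
        exact h2.trans (by gcongr)
    _ = 4 * A / (Real.pi * β) ^ 2 * (M.factorial / β ^ M) *
        (Real.exp (-(Real.pi * β * t / 2)) ^ 2 * Real.exp (β * (1 + t))) := by
        field_simp
        ring
    _ ≤ 4 * A / (Real.pi * β) ^ 2 * (M.factorial / β ^ M) *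
        (Real.exp β * Real.exp (-β * t)) := by gcongr
    _ = _ := by ring

/-- The integral of the representation in the variable `t = tan v`. -/
noncomputable def kernelIntegral (k b : ℂ) : ℂ :=
  ∫ t : ℝ in Ioi 0, csch (Real.pi * b * t) ^ 2 * kernel k t

theorem aestronglyMeasurable_csch_sq_mul_kernel (k : ℂ) {b : ℂ} (hb : 0 < b.re) :
    AEStronglyMeasurable (fun t : ℝ => csch (Real.pi * b * t) ^ 2 * kernel k t)
      (volume.restrict (Ioi 0)) := by
  refine ContinuousOn.aestronglyMeasurable (fun t ht => ?_) measurableSet_Ioi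
  refine ContinuousAt.continuousWithinAt
    (ContinuousAt.mul (ContinuousAt.pow ?_ 2) (continuous_kernel k).continuousAt)
  refine ContinuousAt.div continuousAt_const (by fun_prop) (sinh_ne_zero_of_re_pos ?_)
  rw [re_pi_mul_mul_ofReal]
  have ht' : 0 < t := ht
  positivity

theorem integrableOn_csch_sq_mul_kernel (k : ℂ) {b : ℂ} (hb : 0 < b.re) :
    IntegrableOn (fun t : ℝ => csch (Real.pi * b * t) ^ 2 * kernel k t) (Ioi 0) := by
  obtain ⟨N, hN⟩ := exists_nat_ge ‖k‖
  obtain ⟨C, hC⟩ := exists_norm_csch_sq_mul_kernel_le N hb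
  exact ((integrableOn_exp_mul_Ioi (neg_lt_zero.2 hb) 0).const_mul C).mono'
    (aestronglyMeasurable_csch_sq_mul_kernel k hb)
    (ae_restrict_of_forall_mem measurableSet_Ioi fun t ht => hC k b t hN le_rfl ht)

theorem differentiable_kernelIntegral {b : ℂ} (hb : 0 < b.re) :
    Differentiable ℂ fun k => kernelIntegral k b := by
  rw [← differentiableOn_univ]
  refine differentiableOn_integral_of_locally_dominated isOpen_univ
    (fun k _ => aestronglyMeasurable_csch_sq_mul_kernel k hb)
    (Eventually.of_forall fun t => ((differentiable_kernel t).const_mul _).differentiableOn)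
    fun k₀ _ => ?_
  obtain ⟨N, hN⟩ := exists_nat_gt ‖k₀‖
  obtain ⟨C, hC⟩ := exists_norm_csch_sq_mul_kernel_le N hb
  exact ⟨{k | ‖k‖ < N}, (isOpen_lt continuous_norm continuous_const).mem_nhds hN, _,
    (integrableOn_exp_mul_Ioi (neg_lt_zero.2 hb) 0).const_mul C,
    ae_restrict_of_forall_mem measurableSet_Ioi fun t ht k hk => hC k b t (le_of_lt hk) le_rfl ht⟩

theorem differentiableOn_kernelIntegral (k : ℂ) :
    DifferentiableOn ℂ (fun b => kernelIntegral k b) {b | 0 < b.re} := by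
  refine differentiableOn_integral_of_locally_dominated
    (isOpen_lt continuous_const Complex.continuous_re)
    (fun b hb => aestronglyMeasurable_csch_sq_mul_kernel k hb)
    (ae_restrict_of_forall_mem measurableSet_Ioi fun t ht b hb => ?_) fun b₀ hb₀ => ?_
  · have hre : 0 < (Real.pi * b * t).re := by
      rw [re_pi_mul_mul_ofReal]
      have ht' : 0 < t := ht
      have hb' : 0 < b.re := hb
      positivity
    have h : DifferentiableAt ℂ (fun b : ℂ => csch (Real.pi * b * t)) b :=
      DifferentiableAt.div (differentiableAt_const 1)
        (Complex.differentiable_sinh.differentiableAt.comp b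
          (by fun_prop : DifferentiableAt ℂ (fun b : ℂ => Real.pi * b * t) b))
        (sinh_ne_zero_of_re_pos hre)
    exact ((h.pow 2).mul_const _).differentiableWithinAt
  · have hb₀' : 0 < b₀.re := hb₀
    obtain ⟨N, hN⟩ := exists_nat_ge ‖k‖
    obtain ⟨C, hC⟩ := exists_norm_csch_sq_mul_kernel_le N (half_pos hb₀')
    exact ⟨{b | b₀.re / 2 < b.re}, (isOpen_lt continuous_const
      Complex.continuous_re).mem_nhds (by simp [hb₀']), _,
      (integrableOn_exp_mul_Ioi (neg_lt_zero.2 (half_pos hb₀')) 0).const_mul C,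
      ae_restrict_of_forall_mem measurableSet_Ioi fun t ht b hb => hC k b t hN (le_of_lt hb) ht⟩

/-! ### An integral formula for `t / (1 - e^(-t))`. -/

/-- The partial fraction expansion of `(t/2) coth(t/2) - 1`. -/
theorem hasSum_partial_fractions_coth {t : ℝ} (ht : 0 < t) :
    HasSum (fun n : ℕ => 2 * t ^ 2 / ((2 * Real.pi * (n + 1)) ^ 2 + t ^ 2))
      (t / (1 - Real.exp (-t)) - t / 2 - 1) := by
  have hπ := Real.pi_pos
  -- At this point `exp (2πiz) = exp (-t)`, so the cotangent series for `π cot (πz)` becomes the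
  -- required expansion.
  set z : ℂ := t * Complex.I / (2 * Real.pi) with hz
  have hπ' : (Real.pi : ℂ) ≠ 0 := Complex.ofReal_ne_zero.2 hπ.ne'
  have ht' : (t : ℂ) ≠ 0 := Complex.ofReal_ne_zero.2 ht.ne'
  have hz0 : z ≠ 0 := by
    rw [hz]
    exact div_ne_zero (mul_ne_zero ht' Complex.I_ne_zero) (mul_ne_zero two_ne_zero hπ')
  have him : z.im = t / (2 * Real.pi) := by
    have : z = ((t / (2 * Real.pi) : ℝ) : ℂ) * Complex.I := by rw [hz]; push_cast; ring
    rw [this, Complex.im_ofReal_mul, Complex.I_im, mul_one]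
  have hzc : z ∈ Complex.integerComplement := by
    rintro ⟨m, hm⟩
    have h1 : z.im = 0 := by rw [← hm]; simp
    rw [him] at h1
    exact absurd h1 (by positivity)
  have h := (summable_cotTerm hzc).hasSum.mul_left z
  rw [← cot_series_rep' hzc, Complex.cot_pi_eq_exp_ratio] at h
  have hexp : 2 * Real.pi * Complex.I * z = -(t : ℂ) := by
    rw [hz]
    field_simp
    rw [Complex.I_sq]
  rw [hexp] at h
  have hne : 1 - Real.exp (-t) ≠ 0 := by
    have : Real.exp (-t) < 1 := Real.exp_lt_one_iff.2 (by linarith)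
    linarith
  have hne' : 1 - Complex.exp (-(t : ℂ)) ≠ 0 := by exact_mod_cast hne
  have hval : z * (Real.pi * ((Complex.exp (-(t : ℂ)) + 1) /
      (Complex.I * (1 - Complex.exp (-(t : ℂ))))) - 1 / z) =
      ((t / (1 - Real.exp (-t)) - t / 2 - 1 : ℝ) : ℂ) := by
    rw [mul_sub, mul_one_div_cancel hz0, hz]
    push_cast
    have hI := Complex.I_ne_zero
    field_simp
    ring
  rw [hval] at h
  rw [← Complex.hasSum_ofReal]
  refine h.congr_fun fun n => ?_
  rw [cotTerm_identity hzc]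
  have hden : ((2 * Real.pi * (n + 1)) ^ 2 + t ^ 2 : ℝ) ≠ 0 := by positivity
  have hden' : ((2 * Real.pi * (n + 1)) ^ 2 + t ^ 2 : ℂ) ≠ 0 := by exact_mod_cast hden
  have hprod : (z + (n + 1)) * (z - (n + 1)) =
      -((2 * Real.pi * (n + 1)) ^ 2 + t ^ 2) / (2 * Real.pi) ^ 2 := by
    rw [hz]
    field_simp
    ring_nf
    rw [Complex.I_sq]
    ring
  rw [hprod]
  have hz2 : z * (2 * z * (1 / (-((2 * Real.pi * (n + 1)) ^ 2 + t ^ 2) / (2 * Real.pi) ^ 2))) =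
      2 * z ^ 2 * (1 / (-((2 * Real.pi * (n + 1)) ^ 2 + t ^ 2) / (2 * Real.pi) ^ 2)) := by ring
  have hzsq : z ^ 2 = -(t : ℂ) ^ 2 / (2 * Real.pi) ^ 2 := by
    rw [hz, div_pow, mul_pow, Complex.I_sq]; ring
  rw [hz2, hzsq]
  push_cast
  field_simp

theorem integrableOn_exp_neg_mul_mul_one_sub_cos {a : ℝ} (ha : 0 < a) (t : ℝ) :
    IntegrableOn (fun x => Real.exp (-a * x) * (1 - Real.cos (x * t))) (Ioi 0) := by
  refine ((integrableOn_exp_mul_Ioi (neg_lt_zero.2 ha) 0).const_mul 2).mono'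
    (Continuous.aestronglyMeasurable (by fun_prop)) (Eventually.of_forall fun x => ?_)
  have h1 := Real.cos_le_one (x * t)
  have h2 := Real.neg_one_le_cos (x * t)
  rw [Real.norm_of_nonneg (mul_nonneg (Real.exp_pos _).le (by linarith))]
  nlinarith [Real.exp_pos (-a * x)]

theorem integral_exp_neg_mul_mul_one_sub_cos {a : ℝ} (ha : 0 < a) (t : ℝ) :
    ∫ x in Ioi 0, Real.exp (-a * x) * (1 - Real.cos (x * t)) = t ^ 2 / (a * (a ^ 2 + t ^ 2)) := by
  set w : ℂ := -a + t * Complex.I with hw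
  have hwre : w.re < 0 := by simpa [hw] using ha
  have hden : a ^ 2 + t ^ 2 ≠ 0 := by positivity
  have hint : ∫ x in Ioi 0, Real.exp (-a * x) * Real.cos (x * t) = a / (a ^ 2 + t ^ 2) := by
    have h1 : ∀ x : ℝ, Real.exp (-a * x) * Real.cos (x * t) = RCLike.re (Complex.exp (w * x)) := by
      intro x
      rw [RCLike.re_to_complex, Complex.exp_re]
      simp [hw, mul_comm x t]
    simp_rw [h1]
    rw [integral_re (integrableOn_exp_mul_complex_Ioi hwre 0), integral_exp_mul_complex_Ioi hwre,
      RCLike.re_to_complex]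
    simp only [Complex.ofReal_zero, mul_zero, Complex.exp_zero, Complex.div_re, hw]
    simp [Complex.normSq_apply]
    rw [← sq, ← sq]
  have hint2 : ∫ x in Ioi 0, Real.exp (-a * x) = 1 / a := by
    rw [integral_exp_mul_Ioi (neg_lt_zero.2 ha)]
    simp
  have hi1 := integrableOn_exp_mul_Ioi (neg_lt_zero.2 ha) 0
  have hi2 : IntegrableOn (fun x => Real.exp (-a * x) * Real.cos (x * t)) (Ioi 0) := by
    refine (hi1.sub (integrableOn_exp_neg_mul_mul_one_sub_cos ha t)).congr
      (Eventually.of_forall fun x => ?_)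
    simp only [Pi.sub_apply]
    ring
  simp_rw [mul_sub, mul_one]
  rw [integral_sub hi1 hi2, hint, hint2]
  field_simp
  ring

/-- This is `∑ n r^n = r / (1 - r)^2` with `r = exp (-2πx)`; the vanishing term `n = 0` is dropped,
which shifts the index. -/
theorem hasSum_one_div_sinh_sq {x : ℝ} (hx : 0 < x) :
    HasSum (fun n : ℕ => 4 * ((n : ℝ) + 1) * Real.exp (-(2 * Real.pi * (n + 1)) * x))
      (1 / Real.sinh (Real.pi * x) ^ 2) := by
  have hy : 0 < Real.pi * x := by positivity
  set r := Real.exp (-(2 * (Real.pi * x))) with hr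
  have hr1 : r < 1 := Real.exp_lt_one_iff.2 (by linarith)
  have h := hasSum_coe_mul_geometric_of_norm_lt_one (r := r)
    (by rwa [Real.norm_of_nonneg (Real.exp_pos _).le])
  rw [← hasSum_nat_add_iff' 1] at h
  have h2 := h.mul_left 4
  have hval : 1 / Real.sinh (Real.pi * x) ^ 2 =
      4 * (r / (1 - r) ^ 2 - ∑ i ∈ Finset.range 1, (i : ℝ) * r ^ i) := by
    have he : r = (Real.exp (Real.pi * x) ^ 2)⁻¹ := by
      rw [hr, Real.exp_neg, ← Real.exp_nat_mul]; norm_num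
    have hE : 1 < Real.exp (Real.pi * x) := Real.one_lt_exp_iff.2 hy
    set E := Real.exp (Real.pi * x) with hE'
    have hE0 : E ^ 2 - 1 ≠ 0 := by nlinarith
    simp only [Finset.range_one, Finset.sum_singleton, Nat.cast_zero, zero_mul, sub_zero]
    rw [Real.sinh_eq, Real.exp_neg, ← hE', he]
    have hE1 : E ≠ 0 := by positivity
    have e1 : E - E⁻¹ = (E ^ 2 - 1) / E := by field_simp
    have e2 : 1 - (E ^ 2)⁻¹ = (E ^ 2 - 1) / E ^ 2 := by field_simp
    rw [e1, e2]
    field_simp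
    ring
  rw [hval]
  refine h2.congr_fun fun n => ?_
  rw [hr, ← Real.exp_nat_mul]
  push_cast
  rw [mul_assoc]
  congr 3
  ring

/-- Expanding `1 / sinh²` in exponentials and integrating termwise gives, up to `1/π`, the partial
fractions of the right-hand side. All terms are nonnegative, so summability of their integrals
justifies the exchange. -/
theorem integral_one_sub_cos_div_sinh_sq {t : ℝ} (ht : 0 < t) :
    Real.pi * ∫ x in Ioi 0, 1 / Real.sinh (Real.pi * x) ^ 2 * (1 - Real.cos (x * t)) =
      t / (1 - Real.exp (-t)) - t / 2 - 1 := by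
  have hπ := Real.pi_pos
  set F : ℕ → ℝ → ℝ := fun n x =>
    4 * ((n : ℝ) + 1) * (Real.exp (-(2 * Real.pi * (n + 1)) * x) * (1 - Real.cos (x * t))) with hF
  have ha : ∀ n : ℕ, 0 < 2 * Real.pi * ((n : ℝ) + 1) := fun n => by positivity
  have hFi : ∀ n, Integrable (F n) (volume.restrict (Ioi 0)) := fun n =>
    (integrableOn_exp_neg_mul_mul_one_sub_cos (ha n) t).const_mul _
  have hFint : ∀ n : ℕ, ∫ x in Ioi 0, F n x =
      Real.pi⁻¹ * (2 * t ^ 2 / ((2 * Real.pi * (n + 1)) ^ 2 + t ^ 2)) := by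
    intro n
    have hn : (n : ℝ) + 1 ≠ 0 := by positivity
    have hden : (2 * Real.pi * ((n : ℝ) + 1)) ^ 2 + t ^ 2 ≠ 0 := by positivity
    simp only [hF]
    rw [integral_const_mul, integral_exp_neg_mul_mul_one_sub_cos (ha n)]
    field_simp
    ring
  have hF0 : ∀ n x, ‖F n x‖ = F n x := fun n x => Real.norm_of_nonneg <| by
    have h1 := Real.cos_le_one (x * t)
    have : 0 ≤ 1 - Real.cos (x * t) := by linarith
    positivity
  have hsum := (hasSum_partial_fractions_coth ht).mul_left Real.pi⁻¹
  have key := hasSum_integral_of_summable_integral_norm hFi (by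
    simp_rw [hF0, hFint]
    exact hsum.summable)
  simp_rw [hFint] at key
  have h := key.unique hsum
  have hcongr : ∫ x in Ioi 0, 1 / Real.sinh (Real.pi * x) ^ 2 * (1 - Real.cos (x * t)) =
      ∫ x in Ioi 0, ∑' n, F n x := by
    refine setIntegral_congr_fun measurableSet_Ioi fun x hx => ?_
    have := (hasSum_one_div_sinh_sq hx).mul_right (1 - Real.cos (x * t))
    simp only [mul_assoc] at this
    simp only [hF]
    rw [← this.tsum_eq]
    simp only [mul_assoc]
  rw [hcongr, h]
  field_simp

/-! ### The representation for real `b > 0` and `Re k > 1`. -/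

theorem continuousAt_ofReal_cpow_of_pos {t : ℝ} (ht : 0 < t) (w : ℂ) :
    ContinuousAt (fun t : ℝ => (t : ℂ) ^ w) t :=
  (continuousAt_cpow_const (Complex.ofReal_mem_slitPlane.2 ht)).comp
    Complex.continuous_ofReal.continuousAt

theorem ofReal_mul_cpow {b : ℝ} (hb : 0 < b) {z : ℂ} (hz : z ≠ 0) (w : ℂ) :
    (b * z) ^ w = (b : ℂ) ^ w * z ^ w := by
  have hb' : (b : ℂ) ≠ 0 := Complex.ofReal_ne_zero.2 hb.ne'
  rw [Complex.cpow_def_of_ne_zero (mul_ne_zero hb' hz), Complex.cpow_def_of_ne_zero hb',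
    Complex.cpow_def_of_ne_zero hz, Complex.log_ofReal_mul hb hz, ← Complex.exp_add,
    Complex.ofReal_log hb.le]
  ring_nf

theorem integral_csch_sq_mul_one_sub_cos {b t : ℝ} (hb : 0 < b) (ht : 0 < t) :
    Real.pi * b * ∫ x : ℝ in Ioi 0, csch (Real.pi * b * x) ^ 2 * (1 - Complex.cos (b * x * t)) =
      t / (1 - Complex.exp (-t)) - t / 2 - 1 := by
  have h1 := integral_one_sub_cos_div_sinh_sq ht
  have h2 := integral_comp_mul_left_Ioi
    (fun x => 1 / Real.sinh (Real.pi * x) ^ 2 * (1 - Real.cos (x * t))) 0 hb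
  rw [mul_zero, smul_eq_mul] at h2
  have h3 : ∫ x : ℝ in Ioi 0, csch (Real.pi * b * x) ^ 2 * (1 - Complex.cos (b * x * t)) =
      ((∫ x in Ioi 0, 1 / Real.sinh (Real.pi * (b * x)) ^ 2 *
        (1 - Real.cos (b * x * t)) : ℝ) : ℂ) := by
    rw [← integral_complex_ofReal]
    refine setIntegral_congr_fun measurableSet_Ioi fun x _ => ?_
    simp only [csch]
    push_cast
    rw [mul_assoc, div_pow, one_pow]
  rw [h3, h2]
  have h4 := congrArg (fun r : ℝ => (r : ℂ)) h1
  push_cast at h4 ⊢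
  rw [← h4, mul_assoc, mul_inv_cancel_left₀ (Complex.ofReal_ne_zero.2 hb.ne')]

/-- Writing the cosine as exponentials turns the rate `b` into `b(1 ± ix)`. The resulting powers
`(b(1 ± ix))^(1-k)` factor because `b > 0`, and their mean is the one in `kernel`. -/
theorem integral_cpow_mul_exp_mul_one_sub_cos {k : ℂ} (hk : 1 < k.re) {b : ℝ} (hb : 0 < b)
    (x : ℝ) :
    ∫ t : ℝ in Ioi 0, (t : ℂ) ^ (k - 1 - 1) * Complex.exp (-(b * t)) *
      (1 - Complex.cos (b * x * t)) = Complex.Gamma (k - 1) * b ^ (1 - k) * kernel k x := by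
  have hk' : 0 < (k - 1).re := by simpa using hk
  have hr0 : 0 < (b : ℂ).re := by simpa using hb
  have hr1 : 0 < (b * (1 + x * Complex.I)).re := by simpa using hb
  have hr2 : 0 < (b * (1 - x * Complex.I)).re := by simpa using hb
  have i0 := integrableOn_cpow_mul_exp_neg_mul_Ioi hk' hr0
  have i1 := integrableOn_cpow_mul_exp_neg_mul_Ioi hk' hr1
  have i2 := integrableOn_cpow_mul_exp_neg_mul_Ioi hk' hr2
  have e0 := integral_cpow_mul_exp_neg_mul_Ioi_of_re_pos hk' hr0
  have e1 := integral_cpow_mul_exp_neg_mul_Ioi_of_re_pos hk' hr1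
  have e2 := integral_cpow_mul_exp_neg_mul_Ioi_of_re_pos hk' hr2
  have hsplit : ∀ t : ℝ, (t : ℂ) ^ (k - 1 - 1) * Complex.exp (-(b * t)) *
      (1 - Complex.cos (b * x * t)) = (t : ℂ) ^ (k - 1 - 1) * Complex.exp (-(b * t)) -
        ((t : ℂ) ^ (k - 1 - 1) * Complex.exp (-(b * (1 + x * Complex.I) * t)) +
         (t : ℂ) ^ (k - 1 - 1) * Complex.exp (-(b * (1 - x * Complex.I) * t))) / 2 := by
    intro t
    rw [show -(b * (1 + x * Complex.I) * t) = -(b * t) + -(b * x * t) * Complex.I by ring,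
      show -(b * (1 - x * Complex.I) * t) = -(b * t) + (b * x * t) * Complex.I by ring,
      Complex.exp_add, Complex.exp_add, Complex.cos]
    ring
  simp_rw [hsplit]
  have i12 : IntegrableOn (fun t : ℝ =>
      ((t : ℂ) ^ (k - 1 - 1) * Complex.exp (-(b * (1 + x * Complex.I) * t)) +
        (t : ℂ) ^ (k - 1 - 1) * Complex.exp (-(b * (1 - x * Complex.I) * t))) / 2) (Ioi 0) :=
    (i1.add i2).div_const 2
  rw [integral_sub i0 i12, integral_div, integral_add i1 i2, e0, e1, e2, neg_sub,
    ofReal_mul_cpow hb (Complex.slitPlane_ne_zero (one_add_mul_I_mem_slitPlane x)),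
    ofReal_mul_cpow hb (Complex.slitPlane_ne_zero (one_sub_mul_I_mem_slitPlane x)), kernel]
  ring

/-- Justifies Fubini: `1 - cos y ≤ y² / 2` cancels the `1 / x²` in the bound for `csch²`, leaving
the product of `t^(Re k) e^(-bt)` and a multiple of `e^(-πbx)`. -/
theorem integrable_csch_kernel_prod {k : ℂ} (hk : 1 < k.re) {b : ℝ} (hb : 0 < b) :
    Integrable (Function.uncurry fun t x : ℝ => csch (Real.pi * b * x) ^ 2 *
      ((t : ℂ) ^ (k - 1 - 1) * Complex.exp (-(b * t)) * (1 - Complex.cos (b * x * t))))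
      ((volume.restrict (Ioi 0)).prod (volume.restrict (Ioi 0))) := by
  have hb1 := integrableOn_rpow_mul_exp_neg_mul_rpow (s := k.re) (p := 1) (b := b)
    (by linarith) one_pos hb
  have hb2 := (integrableOn_exp_mul_Ioi (a := -(Real.pi * b))
    (neg_lt_zero.2 (by positivity)) 0).const_mul (2 / Real.pi ^ 2)
  refine (Integrable.mul_prod hb1 hb2).mono' ?_ ?_
  · rw [Measure.prod_restrict]
    refine ContinuousOn.aestronglyMeasurable ?_ (measurableSet_Ioi.prod measurableSet_Ioi)
    rintro ⟨t, x⟩ ⟨ht, hx⟩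
    have ht' : 0 < t := ht
    have hx' : 0 < x := hx
    refine ContinuousAt.continuousWithinAt ?_
    have c1 : ContinuousAt (fun p : ℝ × ℝ => csch (Real.pi * b * p.2)) (t, x) := by
      refine ContinuousAt.div continuousAt_const (by fun_prop) (sinh_ne_zero_of_re_pos ?_)
      rw [re_pi_mul_mul_ofReal, Complex.ofReal_re]
      positivity
    have c2 : ContinuousAt (fun p : ℝ × ℝ => (p.1 : ℂ) ^ (k - 1 - 1)) (t, x) :=
      ContinuousAt.comp (f := Prod.fst) (x := (t, x)) (continuousAt_ofReal_cpow_of_pos ht' _)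
        continuousAt_fst
    exact (c1.pow 2).mul ((c2.mul (by fun_prop)).mul (by fun_prop))
  · rw [Measure.prod_restrict]
    refine ae_restrict_of_forall_mem (measurableSet_Ioi.prod measurableSet_Ioi) ?_
    rintro ⟨t, x⟩ ⟨ht, hx⟩
    have ht' : 0 < t := ht
    have hx' : 0 < x := hx
    have n1 : ‖csch (Real.pi * b * x)‖ ≤ _ := norm_csch_le (x := Real.pi * b * x) (by positivity)
      (by rw [re_pi_mul_mul_ofReal, Complex.ofReal_re])
    have n2 : ‖1 - Complex.cos (b * x * t)‖ ≤ (b * x * t) ^ 2 / 2 := by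
      have : 1 - Complex.cos (b * x * t) = ((1 - Real.cos (b * x * t) : ℝ) : ℂ) := by push_cast; rfl
      rw [this, Complex.norm_real, Real.norm_of_nonneg (by linarith [Real.cos_le_one (b * x * t)])]
      linarith [Real.one_sub_sq_div_two_le_cos (x := b * x * t)]
    have n3 : ‖(t : ℂ) ^ (k - 1 - 1)‖ * t ^ 2 = t ^ k.re := by
      rw [Complex.norm_cpow_eq_rpow_re_of_pos ht', ← Real.rpow_natCast, ← Real.rpow_add ht']
      congr 1
      simp only [Complex.sub_re, Complex.one_re, Nat.cast_ofNat]
      ring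
    have n4 : ‖Complex.exp (-(b * t))‖ = Real.exp (-b * t) := by
      rw [Complex.norm_exp]; simp
    simp only [Function.uncurry]
    rw [norm_mul, norm_mul, norm_mul, norm_pow, n4, Real.rpow_one]
    calc _ ≤ (2 * Real.exp (-(Real.pi * b * x / 2)) / (Real.pi * b * x)) ^ 2 *
          (‖(t : ℂ) ^ (k - 1 - 1)‖ * Real.exp (-b * t) * ((b * x * t) ^ 2 / 2)) := by gcongr
      _ = ‖(t : ℂ) ^ (k - 1 - 1)‖ * t ^ 2 * Real.exp (-b * t) *
          (2 / Real.pi ^ 2 * Real.exp (-(Real.pi * b * x / 2)) ^ 2) := by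
          field_simp
      _ = _ := by
          rw [n3, ← Real.exp_nat_mul]
          congr 3
          push_cast
          ring

/-- The right-hand side of the integral representation in the variable `t = tan v`. -/
noncomputable def zetaFormula (k b : ℂ) : ℂ :=
  b ^ (1 - k) / (k - 1) + b ^ (-k) / 2 + Real.pi * b ^ (2 - k) / (k - 1) * kernelIntegral k b

theorem integral_cpow_mul_exp_div_eq {k : ℂ} (hk : 1 < k.re) {b : ℝ} (hb : 0 < b) :
    ∫ t : ℝ in Ioi 0, (t : ℂ) ^ (k - 1) * (Complex.exp (-(b * t)) / (1 - Complex.exp (-t))) =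
      Complex.Gamma k * zetaFormula k b := by
  have hk0 : 0 < k.re := by linarith
  have hk' : 0 < (k - 1).re := by simpa using hk
  have hr0 : 0 < (b : ℂ).re := by simpa using hb
  have hb' : (b : ℂ) ≠ 0 := Complex.ofReal_ne_zero.2 hb.ne'
  have hk1 : k - 1 ≠ 0 := fun h => by rw [h] at hk'; simp at hk'
  have hπ : (Real.pi : ℂ) ≠ 0 := Complex.ofReal_ne_zero.2 Real.pi_ne_zero
  have i0 := integrableOn_cpow_mul_exp_neg_mul_Ioi hk' hr0
  have i1 := (integrableOn_cpow_mul_exp_neg_mul_Ioi hk0 hr0).div_const 2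
  have hG := integrable_csch_kernel_prod hk hb
  have i2 := hG.integral_prod_left.const_mul (Real.pi * b)
  simp only [Function.uncurry] at i2
  have hswap := integral_integral_swap hG
  simp_rw [integral_const_mul, integral_cpow_mul_exp_mul_one_sub_cos hk hb] at hswap
  -- One factor `t` of `t^(k-1)` is moved to form `t / (1 - e^(-t))`, whose pieces `1`, `t/2` and
  -- the integral give the three terms of `zetaFormula`.
  have hsplit : ∀ t ∈ Ioi (0 : ℝ),
      (t : ℂ) ^ (k - 1) * (Complex.exp (-(b * t)) / (1 - Complex.exp (-t))) =
      (t : ℂ) ^ (k - 1 - 1) * Complex.exp (-(b * t)) +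
        (t : ℂ) ^ (k - 1) * Complex.exp (-(b * t)) / 2 +
        Real.pi * b * ∫ x : ℝ in Ioi 0, csch (Real.pi * b * x) ^ 2 *
          ((t : ℂ) ^ (k - 1 - 1) * Complex.exp (-(b * t)) * (1 - Complex.cos (b * x * t))) := by
    intro t ht
    have ht' : 0 < t := ht
    have ht0 : (t : ℂ) ≠ 0 := Complex.ofReal_ne_zero.2 ht'.ne'
    have h1 : ∀ x : ℝ, csch (Real.pi * b * x) ^ 2 *
        ((t : ℂ) ^ (k - 1 - 1) * Complex.exp (-(b * t)) * (1 - Complex.cos (b * x * t))) =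
        (t : ℂ) ^ (k - 1 - 1) * Complex.exp (-(b * t)) *
          (csch (Real.pi * b * x) ^ 2 * (1 - Complex.cos (b * x * t))) := fun x => by ring
    have h2 : (t : ℂ) ^ (k - 1) = (t : ℂ) ^ (k - 1 - 1) * t := by
      rw [Complex.cpow_sub (k - 1) 1 ht0, Complex.cpow_one, div_mul_cancel₀ _ ht0]
    simp_rw [h1]
    rw [integral_const_mul, mul_left_comm, integral_csch_sq_mul_one_sub_cos hb ht', h2]
    ring
  have hGamma : Complex.Gamma k = (k - 1) * Complex.Gamma (k - 1) := by
    rw [← Complex.Gamma_add_one _ hk1, sub_add_cancel]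
  have hpow : (b : ℂ) ^ (2 - k) = b * b ^ (1 - k) := by
    rw [show 2 - k = 1 + (1 - k) by ring, Complex.cpow_add _ _ hb', Complex.cpow_one]
  rw [setIntegral_congr_fun measurableSet_Ioi hsplit]
  have hadd := integral_add (i0.add i1) i2
  have hadd' := integral_add i0 i1
  simp only [Pi.add_apply] at hadd
  rw [hadd, hadd', integral_const_mul, integral_div,
    integral_cpow_mul_exp_neg_mul_Ioi_of_re_pos hk' hr0,
    integral_cpow_mul_exp_neg_mul_Ioi_of_re_pos hk0 hr0, hswap]
  have hJ : ∫ x : ℝ in Ioi 0, csch (Real.pi * b * x) ^ 2 *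
      (Complex.Gamma (k - 1) * b ^ (1 - k) * kernel k x) =
      Complex.Gamma (k - 1) * b ^ (1 - k) * kernelIntegral k b := by
    rw [kernelIntegral, ← integral_const_mul]
    exact integral_congr_ae (Eventually.of_forall fun x => by ring)
  rw [hJ, zetaFormula, neg_sub, hpow, hGamma]
  field_simp

theorem summable_one_div_add_rpow {b σ : ℝ} (hb : 0 < b) (hσ : 1 < σ) :
    Summable fun n : ℕ => 1 / ((n : ℝ) + b) ^ σ := by
  refine ((Real.summable_one_div_nat_add_rpow b σ).2 hσ).congr fun n => ?_
  rw [abs_of_pos (by positivity)]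

/-- The integral representation for a positive real parameter. -/
theorem hasSum_zetaFormula_ofReal {k : ℂ} (hk : 1 < k.re) {b : ℝ} (hb : 0 < b) :
    HasSum (fun n : ℕ => ((n : ℂ) + b) ^ (-k)) (zetaFormula k b) := by
  have hk0 : 0 < k.re := by linarith
  have h := hasSum_mellin (a := fun _ : ℕ => (1 : ℂ)) (p := fun n : ℕ => (n : ℝ) + b)
    (F := fun t : ℝ => Complex.exp (-(b * t)) / (1 - Complex.exp (-t))) (s := k)
    (fun n => Or.inr (by positivity)) hk0 ?_ ?_
  · simp only [mellin, smul_eq_mul] at h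
    rw [integral_cpow_mul_exp_div_eq hk hb] at h
    have h2 := h.mul_left (Complex.Gamma k)⁻¹
    have hG := Complex.Gamma_ne_zero_of_re_pos hk0
    rw [inv_mul_cancel_left₀ hG] at h2
    refine h2.congr_fun fun n => ?_
    rw [Complex.cpow_neg]
    push_cast
    field_simp
  · intro t ht
    have ht' : 0 < t := ht
    have hg := (hasSum_geometric_of_norm_lt_one (ξ := Complex.exp (-(t : ℂ))) (by
      rw [Complex.norm_exp]
      simpa using ht')).mul_left (Complex.exp (-(b * t)))
    rw [← div_eq_mul_inv] at hg
    refine hg.congr_fun fun n => ?_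
    rw [← Complex.exp_nat_mul, ← Complex.exp_add, one_mul]
    push_cast
    ring_nf
  · simpa using summable_one_div_add_rpow hb hk

/-! ### Continuation in `b`, then in `k`. -/

/-- A majorant uniform on `Re b ≥ β`, for the Weierstrass test. -/
theorem norm_natCast_add_cpow_neg_le {k b : ℂ} (hk : 1 < k.re) {β : ℝ} (hβ : 0 < β)
    (hb : β ≤ b.re) (n : ℕ) :
    ‖((n : ℂ) + b) ^ (-k)‖ ≤ Real.exp (Real.pi * |k.im|) * (1 / ((n : ℝ) + β) ^ k.re) := by
  set z : ℂ := n + b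
  have hz : (n : ℝ) + β ≤ ‖z‖ := by
    refine le_trans ?_ (Complex.re_le_norm z)
    simpa [z] using hb
  have hz0 : 0 < (n : ℝ) + β := by positivity
  have h2 : z.arg * k.im ≤ Real.pi * |k.im| := by
    refine (le_abs_self _).trans ?_
    rw [abs_mul]
    exact mul_le_mul_of_nonneg_right (Complex.abs_arg_le_pi z) (abs_nonneg _)
  calc ‖z ^ (-k)‖ ≤ ‖z‖ ^ (-k).re / Real.exp (z.arg * (-k).im) := Complex.norm_cpow_le z (-k)
    _ = Real.exp (z.arg * k.im) * (1 / ‖z‖ ^ k.re) := by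
        rw [Complex.neg_re, Complex.neg_im, mul_neg, Real.exp_neg,
          Real.rpow_neg (hz0.trans_le hz).le]
        field_simp
    _ ≤ _ := by gcongr

theorem differentiableOn_tsum_natCast_add_cpow {k : ℂ} (hk : 1 < k.re) :
    DifferentiableOn ℂ (fun b => ∑' n : ℕ, ((n : ℂ) + b) ^ (-k)) {b | 0 < b.re} := by
  intro b₀ hb₀
  have hb₀' : 0 < b₀.re := hb₀
  have ho : IsOpen {b : ℂ | b₀.re / 2 < b.re} := isOpen_lt continuous_const Complex.continuous_re
  have h := Complex.differentiableOn_tsum_of_summable_norm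
    (F := fun (n : ℕ) (b : ℂ) => ((n : ℂ) + b) ^ (-k))
    ((summable_one_div_add_rpow (half_pos hb₀') hk).mul_left (Real.exp (Real.pi * |k.im|)))
    (fun n b hb => ?_) ho
    (fun n b hb => norm_natCast_add_cpow_neg_le hk (half_pos hb₀') (le_of_lt hb) n)
  · exact (h.differentiableAt (ho.mem_nhds (by simp [hb₀']))).differentiableWithinAt
  · have hb' : b₀.re / 2 < b.re := hb
    have hmem : (n : ℂ) + b ∈ Complex.slitPlane := Or.inl (by
      rw [Complex.add_re, Complex.natCast_re]
      have : (0 : ℝ) ≤ n := n.cast_nonneg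
      linarith)
    exact (DifferentiableAt.cpow_const (differentiableAt_id.const_add _)
      hmem).differentiableWithinAt

theorem differentiableOn_zetaFormula_right (k : ℂ) :
    DifferentiableOn ℂ (fun b => zetaFormula k b) {b | 0 < b.re} := by
  have hp : ∀ w : ℂ, DifferentiableOn ℂ (fun b : ℂ => b ^ w) {b | 0 < b.re} := fun w b hb =>
    (differentiableAt_id.cpow_const (Or.inl hb)).differentiableWithinAt
  exact (((hp (1 - k)).div_const _).add ((hp (-k)).div_const _)).add
    ((((hp (2 - k)).const_mul _).div_const _).mul (differentiableOn_kernelIntegral k))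

/-- The integral representation for `Re k > 1`. -/
theorem hasSum_zetaFormula {k b : ℂ} (hk : 1 < k.re) (hb : 0 < b.re) :
    HasSum (fun n : ℕ => ((n : ℂ) + b) ^ (-k)) (zetaFormula k b) := by
  have h := eqOn_re_pos_of_eq_ofReal (differentiableOn_tsum_natCast_add_cpow hk)
    (differentiableOn_zetaFormula_right k)
    (fun x hx => (hasSum_zetaFormula_ofReal hk hx).tsum_eq) hb
  have hs : Summable fun n : ℕ => ((n : ℂ) + b) ^ (-k) :=
    Summable.of_norm_bounded
      ((summable_one_div_add_rpow hb hk).mul_left (Real.exp (Real.pi * |k.im|)))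
      (norm_natCast_add_cpow_neg_le hk hb le_rfl)
  have hsum := hs.hasSum
  rwa [show ∑' n : ℕ, ((n : ℂ) + b) ^ (-k) = zetaFormula k b from h] at hsum

/-- `kernelIntegral` is entire in `k`, so only the factors `1 / (k - 1)` restrict the domain; this
also proves that a continuation exists. -/
theorem isHurwitzZeta_zetaFormula {b : ℂ} (hb : 0 < b.re) :
    IsHurwitzZeta b fun k => zetaFormula k b := by
  have hb0 : b ≠ 0 := fun h => by simp [h] at hb
  refine ⟨fun k hk => ?_, fun k hk => hasSum_zetaFormula hk hb⟩
  have hk1 : k - 1 ≠ 0 := sub_ne_zero.2 hk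
  have h0 : DifferentiableAt ℂ (fun k : ℂ => k - 1) k := by fun_prop
  have h1 : DifferentiableAt ℂ (fun k : ℂ => b ^ (1 - k)) k :=
    DifferentiableAt.const_cpow (by fun_prop) (Or.inl hb0)
  have h2 : DifferentiableAt ℂ (fun k : ℂ => b ^ (-k)) k :=
    DifferentiableAt.const_cpow (by fun_prop) (Or.inl hb0)
  have h3 : DifferentiableAt ℂ (fun k : ℂ => b ^ (2 - k)) k :=
    DifferentiableAt.const_cpow (by fun_prop) (Or.inl hb0)
  exact (((h1.div h0 hk1).add (h2.div_const 2)).add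
    (((h3.const_mul _).div h0 hk1).mul (differentiable_kernelIntegral hb k))).differentiableWithinAt

theorem IsHurwitzZeta.hurwitzZeta {b : ℂ} {Z : ℂ → ℂ} (hZ : IsHurwitzZeta b Z) :
    IsHurwitzZeta b fun k => hurwitzZeta k b := by
  have h : ∃ Z : ℂ → ℂ, IsHurwitzZeta b Z := ⟨Z, hZ⟩
  have he : (fun k => HurwitzInt.hurwitzZeta k b) = h.choose := by
    funext k
    rw [HurwitzInt.hurwitzZeta, dif_pos h]
  rw [he]
  exact h.choose_spec

theorem hurwitzZeta_eq_zetaFormula {k b : ℂ} (hk : k ≠ 1) (hb : 0 < b.re) :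
    hurwitzZeta k b = zetaFormula k b :=
  (isHurwitzZeta_zetaFormula hb).hurwitzZeta.eqOn (isHurwitzZeta_zetaFormula hb) hk

/-! ### The substitution `t = tan v`. -/

theorem tan_image_Ioo_zero_pi_div_two : Real.tan '' Ioo 0 (Real.pi / 2) = Ioi 0 := by
  ext t
  constructor
  · rintro ⟨v, hv, rfl⟩
    exact Real.tan_pos_of_pos_of_lt_pi_div_two hv.1 hv.2
  · intro ht
    exact ⟨Real.arctan t, ⟨Real.arctan_pos.2 ht, Real.arctan_lt_pi_div_two t⟩, Real.tan_arctan t⟩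

theorem exp_mul_I_cpow {v : ℝ} (hv : |v| < Real.pi) (w : ℂ) :
    Complex.exp (v * Complex.I) ^ w = Complex.exp (w * v * Complex.I) := by
  obtain ⟨h1, h2⟩ := abs_lt.1 hv
  rw [Complex.cpow_def_of_ne_zero (Complex.exp_ne_zero _), Complex.log_exp (by simpa using h1)
    (by simpa using h2.le)]
  ring_nf

/-- Because `1 + i tan v = exp (iv) / cos v` with `cos v > 0` and `v` within the principal range of
the argument. -/
theorem one_add_tan_mul_I_cpow {v : ℝ} (hv : |v| < Real.pi / 2) (w : ℂ) :
    (1 + Real.tan v * Complex.I) ^ w = Complex.exp (w * v * Complex.I) / Complex.cos v ^ w := by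
  obtain ⟨h1, h2⟩ := abs_lt.1 hv
  have hcos : 0 < Real.cos v := Real.cos_pos_of_mem_Ioo ⟨h1, h2⟩
  have hcos' : Complex.cos v ≠ 0 := by
    rw [← Complex.ofReal_cos]; exact Complex.ofReal_ne_zero.2 hcos.ne'
  have h : 1 + Real.tan v * Complex.I =
      (((Real.cos v)⁻¹ : ℝ) : ℂ) * Complex.exp (v * Complex.I) := by
    rw [Complex.exp_mul_I, Real.tan_eq_sin_div_cos]
    push_cast
    field_simp
  rw [h, ofReal_mul_cpow (inv_pos.2 hcos) (Complex.exp_ne_zero _),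
    exp_mul_I_cpow (hv.trans (by linarith [Real.pi_pos])), Complex.ofReal_inv, Complex.inv_cpow,
    Complex.ofReal_cos, div_eq_inv_mul]
  rw [Complex.arg_ofReal_of_nonneg hcos.le]
  exact Real.pi_pos.ne

theorem kernel_tan {v : ℝ} (hv : |v| < Real.pi / 2) (k : ℂ) :
    kernel k (Real.tan v) = 1 - Complex.cos ((k - 1) * v) / Complex.cos v ^ (1 - k) := by
  have h1 := one_add_tan_mul_I_cpow hv (1 - k)
  have h2 := one_add_tan_mul_I_cpow (v := -v) (by rwa [abs_neg]) (1 - k)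
  rw [Real.tan_neg, Complex.ofReal_neg, Complex.ofReal_neg, neg_mul, ← sub_eq_add_neg,
    Complex.cos_neg] at h2
  rw [kernel, h1, h2, Complex.cos.eq_1 ((k - 1) * v),
    show (1 - k) * (v : ℂ) * Complex.I = -((k - 1) * v) * Complex.I by ring,
    show (1 - k) * -(v : ℂ) * Complex.I = (k - 1) * v * Complex.I by ring]
  ring

/-- The factor `sec² v` is the Jacobian of the substitution. -/
theorem integrand_eq_abs_deriv_tan_smul (k b : ℂ) {v : ℝ} (hv : v ∈ Ioo 0 (Real.pi / 2)) :
    |1 / Real.cos v ^ 2| • (csch (Real.pi * b * Real.tan v) ^ 2 * kernel k (Real.tan v)) =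
      integrand k b v := by
  have hv' : |v| < Real.pi / 2 := by rw [abs_of_pos hv.1]; exact hv.2
  rw [kernel_tan hv', integrand, abs_of_nonneg (by positivity), Complex.real_smul, sec]
  push_cast
  ring

theorem hasDerivWithinAt_tan_Ioo {v : ℝ} (hv : v ∈ Ioo 0 (Real.pi / 2)) :
    HasDerivWithinAt Real.tan (1 / Real.cos v ^ 2) (Ioo 0 (Real.pi / 2)) v :=
  (Real.hasDerivAt_tan (Real.cos_pos_of_mem_Ioo
    ⟨by linarith [hv.1, Real.pi_pos], hv.2⟩).ne').hasDerivWithinAt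

theorem injOn_tan_Ioo_zero_pi_div_two : InjOn Real.tan (Ioo 0 (Real.pi / 2)) :=
  Real.injOn_tan.mono (Ioo_subset_Ioo_left (by linarith [Real.pi_pos]))

theorem intervalIntegrable_integrand (k : ℂ) {b : ℂ} (hb : 0 < b.re) :
    IntervalIntegrable (integrand k b) volume 0 (Real.pi / 2) := by
  rw [intervalIntegrable_iff_integrableOn_Ioo_of_le (by positivity)]
  have h := integrableOn_csch_sq_mul_kernel k hb
  rw [← tan_image_Ioo_zero_pi_div_two, integrableOn_image_iff_integrableOn_abs_deriv_smul
    measurableSet_Ioo (fun v hv => hasDerivWithinAt_tan_Ioo hv)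
    injOn_tan_Ioo_zero_pi_div_two] at h
  exact h.congr_fun (fun v hv => integrand_eq_abs_deriv_tan_smul k b hv) measurableSet_Ioo

theorem integral_integrand (k b : ℂ) :
    ∫ v in (0 : ℝ)..(Real.pi / 2), integrand k b v = kernelIntegral k b := by
  rw [intervalIntegral.integral_of_le (by positivity), integral_Ioc_eq_integral_Ioo,
    kernelIntegral, ← tan_image_Ioo_zero_pi_div_two,
    integral_image_eq_integral_abs_deriv_smul measurableSet_Ioo
      (fun v hv => hasDerivWithinAt_tan_Ioo hv) injOn_tan_Ioo_zero_pi_div_two]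
  exact (setIntegral_congr_fun measurableSet_Ioo
    fun v hv => integrand_eq_abs_deriv_tan_smul k b hv).symm

/-! ### Failure for `Re b < 0`. -/

theorem integrand_neg (k b : ℂ) : integrand k (-b) = integrand k b := by
  funext v
  simp only [integrand, csch, mul_neg, neg_mul, Complex.sinh_neg, div_neg, neg_sq]

/-- The Hurwitz zeta function with parameter `b` from the one with parameter `b + 1`. -/
theorem IsHurwitzZeta.of_add_one {b : ℂ} (hb : b ≠ 0) {Z : ℂ → ℂ} (hZ : IsHurwitzZeta (b + 1) Z) :
    IsHurwitzZeta b fun k => b ^ (-k) + Z k := by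
  refine ⟨DifferentiableOn.add (fun k _ => ?_) hZ.1, fun k hk => ?_⟩
  · exact (DifferentiableAt.const_cpow (by fun_prop) (Or.inl hb)).differentiableWithinAt
  · have h := hZ.2 k hk
    have h2 : HasSum (fun n : ℕ => (((n + 1 : ℕ) : ℂ) + b) ^ (-k)) (Z k) := by
      refine h.congr_fun fun n => ?_
      push_cast
      ring_nf
    rw [hasSum_nat_add_iff (f := fun n : ℕ => ((n : ℂ) + b) ^ (-k)) 1] at h2
    simpa [add_comm] using h2

theorem hurwitzZeta_two_one_half_ne_zero : hurwitzZeta 2 (1 / 2) ≠ 0 := by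
  intro h0
  have hre : 0 < (1 / 2 : ℂ).re := by norm_num
  have h := (isHurwitzZeta_zetaFormula hre).hurwitzZeta.2 2 (by simp)
  simp only [h0] at h
  have h2 : HasSum (fun n : ℕ => (((n : ℝ) + 1 / 2) ^ 2)⁻¹) 0 := by
    rw [← Complex.hasSum_ofReal]
    refine (h.congr_fun fun n => ?_)
    rw [Complex.cpow_neg, Complex.cpow_ofNat]
    push_cast
    rfl
  have h3 := (hasSum_zero_iff_of_nonneg (fun n => by positivity)).1 h2
  have h4 := congrFun h3 0
  norm_num at h4

theorem hurwitzZeta_two_neg_one_half_ne_integralFormula :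
    hurwitzZeta 2 (-(1 / 2)) ≠ integralFormula 2 (-(1 / 2)) := by
  have hre : 0 < (1 / 2 : ℂ).re := by norm_num
  have hZ : IsHurwitzZeta (-(1 / 2) + 1) fun k => hurwitzZeta k (1 / 2) := by
    rw [show -(1 / 2 : ℂ) + 1 = 1 / 2 by norm_num]
    exact (isHurwitzZeta_zetaFormula hre).hurwitzZeta
  have hZ' := hZ.of_add_one (by norm_num)
  have h1 : hurwitzZeta 2 (-(1 / 2)) = (-(1 / 2) : ℂ) ^ (-2 : ℂ) + hurwitzZeta 2 (1 / 2) :=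
    hZ'.hurwitzZeta.eqOn hZ' (by simp)
  have h2 : hurwitzZeta 2 (1 / 2) = zetaFormula 2 (1 / 2) :=
    hurwitzZeta_eq_zetaFormula (by norm_num) hre
  have hne := hurwitzZeta_two_one_half_ne_zero
  have hsign : Real.sign (-(1 / 2) : ℂ).re = -1 := Real.sign_of_neg (by norm_num)
  intro h
  rw [h1, integralFormula, integrand_neg, integral_integrand, hsign] at h
  rw [h2] at h hne
  rw [zetaFormula] at h hne
  simp only [show (1 - 2 : ℂ) = -1 by norm_num, show (2 - 1 : ℂ) = 1 by norm_num, sub_self,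
    Complex.cpow_neg, Complex.cpow_ofNat, Complex.cpow_one, Complex.cpow_zero] at h hne
  push_cast at h
  apply hne
  -- With `ζ = ζ(2,1/2) = 4 + πK`, where `K` is the kernel integral, the formula at `-1/2` equals
  -- `-2 + 2 - πK = 4 - ζ`, whereas the zeta value is `4 + ζ`.
  linear_combination h / 2

end HurwitzInt

/-- For `Re b > 0` the Hurwitz zeta function `ζ(·, b)` exists on `ℂ \ {1}`, and there it is given by
the (convergent) integral representation; for `Re b < 0` the representation can fail. -/
theorem mainTheorem1 :
    (∀ b : ℂ, 0 < b.re →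
      HurwitzInt.IsHurwitzZeta b (fun k => HurwitzInt.hurwitzZeta k b) ∧
      ∀ k : ℂ, k ≠ 1 →
        IntervalIntegrable (HurwitzInt.integrand k b) MeasureTheory.volume 0 (Real.pi / 2) ∧
        HurwitzInt.hurwitzZeta k b =
          b ^ (1 - k) / (k - 1) + b ^ (-k) / 2 +
            Real.pi * b ^ (2 - k) / (k - 1) *
              ∫ v in (0 : ℝ)..(Real.pi / 2),
                (HurwitzInt.sec v * HurwitzInt.csch (Real.pi * b * Complex.tan v)) ^ 2 *
                  (1 - Complex.cos ((k - 1) * v) / Complex.cos v ^ (1 - k))) ∧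
    (∃ k b : ℂ, k ≠ 1 ∧ b.re < 0 ∧ (∀ n : ℕ, (n : ℂ) + b ≠ 0) ∧
      HurwitzInt.IsHurwitzZeta b (fun k => HurwitzInt.hurwitzZeta k b) ∧
      IntervalIntegrable (HurwitzInt.integrand k b) MeasureTheory.volume 0 (Real.pi / 2) ∧
      HurwitzInt.hurwitzZeta k b ≠ HurwitzInt.integralFormula k b) := by
  refine ⟨fun b hb => ⟨(HurwitzInt.isHurwitzZeta_zetaFormula hb).hurwitzZeta, fun k hk =>
    ⟨HurwitzInt.intervalIntegrable_integrand k hb, ?_⟩⟩, 2, -(1 / 2), by norm_num, by norm_num,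
    fun n h => ?_, ?_, ?_, HurwitzInt.hurwitzZeta_two_neg_one_half_ne_integralFormula⟩
  · rw [HurwitzInt.hurwitzZeta_eq_zetaFormula hk hb, HurwitzInt.zetaFormula,
      ← HurwitzInt.integral_integrand]
    rfl
  · have h2 : ((2 * n : ℕ) : ℂ) = (1 : ℕ) := by
      push_cast
      linear_combination 2 * h
    have h3 : 2 * n = 1 := Nat.cast_injective h2
    omega
  · have hZ := HurwitzInt.isHurwitzZeta_zetaFormula (b := -(1 / 2) + 1) (by norm_num)
    exact (hZ.of_add_one (by norm_num)).hurwitzZeta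
  · rw [HurwitzInt.integrand_neg]
    exact HurwitzInt.intervalIntegrable_integrand 2 (by norm_num)
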